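/- For every real number $\beta\in[1,\infty)$ there exists a family $\mathcal X=\{G_\delta\}_{\delta\in(0,\infty)}$ of finite connected graphs, each equipped with its shortest-path metric, such that $$\dim_{\mathrm{Assouad}}\mathcal X=\beta .$$ Here the Assouad dimension of a family $\{(X_\lambda,d_\lambda)\}_{\lambda\in I}$ of metric spaces is the infimum of all exponents $\alpha\in\mathbb R$ for which there is a constant $C>0$ such that for every $\lambda\in I$, every $x\in X_\lambda$ and all $0<r<R$, the closed ball of radius $R$ about $x$ in $X_\lambda$ can be covered by at most $C\,(R/r)^{\alpha}$ closed balls of radius $r$ with centres in $X_\lambda$ (the infimum is $+\infty$ if there is no such exponent). -/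

import Mathlib

/-- The shortest-path metric on the vertex set of a connected graph. -/
noncomputable abbrev shortestPathMetric {V : Type*} (G : SimpleGraph V) (hG : G.Connected) :
    MetricSpace V where
  dist u v := (G.dist u v : ℝ)
  dist_self u := by simp
  dist_comm u v := by rw [SimpleGraph.dist_comm]
  dist_triangle u v w := by exact_mod_cast hG.dist_triangle
  eq_of_dist_eq_zero {u v} h := hG.dist_eq_zero_iff.mp (by exact_mod_cast h)

/-- The uniform covering condition with exponent `β` for a family of metric spaces: one constant
`C` serves all members of the family, all centres `x` and all scales `0 < r < R`, such that the
ball of radius `R` about `x` is covered by at most `C * (R / r) ^ β` balls of radius `r`. -/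
def CoveringCondition {ι : Type*} (X : ι → Type*) (m : ∀ i, MetricSpace (X i)) (β : ℝ) : Prop :=
  ∃ C : ℝ, 0 < C ∧ ∀ (i : ι) (x : X i) (r R : ℝ), 0 < r → r < R →
    ∃ F : Finset (X i), (F.card : ℝ) ≤ C * (R / r) ^ β ∧
      Metric.closedBall x R ⊆ ⋃ y ∈ F, Metric.closedBall y r

/-- The Assouad dimension of a family of metric spaces: the infimum of the exponents that satisfy
the uniform covering condition (`⊤` if there are none). -/
noncomputable def assouadDim {ι : Type*} (X : ι → Type*) (m : ∀ i, MetricSpace (X i)) : EReal :=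
  sInf {b : EReal | ∃ β : ℝ, b = (β : EReal) ∧ CoveringCondition X m β}

/-! Take trees in which a vertex on level `h` has about `(h + 1) ^ β` leaves below it, one tree for
each height. From the root of the tree of height `H`, radius `H` reaches about `H ^ β` leaves, and
balls of radius `1 / 2` are singletons; this forces exponent at least `β`
(`le_of_coveringCondition_canopyTree`).

Conversely, cut the levels into bands of about `r / 2` levels. Vertices of one band with the same
ancestor on its top level are within `r`, so one ball serves them all. A ball of radius `R` meets
O(`R / r`) bands and lies below one vertex on top of the last band `J`, so band `j` costs O(`((J +
1) / (j + 1)) ^ β`) balls (`canopyTree_exists_cover`). With `β` raised to any `b > β ≥ 1`, hence `b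
> 1`, the sum over bands is O(`(R / r) ^ b`) by `sum_Icc_div_rpow_le`. -/

/-- The position, on level `T`, of the ancestor of the vertex `p = (level, position)`, in the
canopy tree whose level `h` groups the leaves into blocks of size `2 ^ k h`. -/
def canopyAncestor (k : ℕ → ℕ) (T : ℕ) (p : ℕ × ℕ) : ℕ :=
  p.2 / 2 ^ (k T - k p.1)

theorem canopyAncestor_self (k : ℕ → ℕ) (p : ℕ × ℕ) : canopyAncestor k p.1 p = p.2 := by
  simp [canopyAncestor]

theorem canopyAncestor_canopyAncestor {k : ℕ → ℕ} (hk : Monotone k) {S T : ℕ} {p : ℕ × ℕ}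
    (hS : p.1 ≤ S) (hT : S ≤ T) :
    canopyAncestor k T (S, canopyAncestor k S p) = canopyAncestor k T p := by
  have h1 := hk hS
  have h2 := hk hT
  simp only [canopyAncestor]
  rw [Nat.div_div_eq_div_mul, ← pow_add]
  congr 2
  omega

/-- The vertices of the canopy tree with root on level `H`. -/
def CanopyVertex (k : ℕ → ℕ) (H : ℕ) : Type :=
  {p : ℕ × ℕ // p.1 ≤ H ∧ p.2 * 2 ^ k p.1 < 2 ^ k H}

/-- The canopy tree with root on level `H`: each vertex below the root is joined to its ancestor
on the next level. -/
def canopyTree (k : ℕ → ℕ) (H : ℕ) : SimpleGraph (CanopyVertex k H) where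
  Adj p q := (q.1.1 = p.1.1 + 1 ∧ q.1.2 = canopyAncestor k q.1.1 p.1) ∨
    (p.1.1 = q.1.1 + 1 ∧ p.1.2 = canopyAncestor k p.1.1 q.1)
  symm := ⟨fun _ _ h => h.symm⟩
  loopless := ⟨fun p h => by omega⟩

/-! ### Ancestors, walks and distances in the canopy tree -/

section CanopyTree

variable {k : ℕ → ℕ} {H : ℕ}

/-- The root of the canopy tree. -/
def canopyRoot (k : ℕ → ℕ) (H : ℕ) : CanopyVertex k H :=
  ⟨(H, 0), le_rfl, by simp⟩

instance canopyVertex_finite : Finite (CanopyVertex k H) := by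
  refine Set.Finite.to_subtype ((Set.finite_Iic (H, 2 ^ k H)).subset ?_)
  rintro ⟨h, a⟩ ⟨h1, h2⟩
  refine ⟨h1, ?_⟩
  have : 1 ≤ 2 ^ k h := Nat.one_le_two_pow
  simp only at h2 ⊢
  nlinarith

theorem exists_walk_to_ancestor (hk : Monotone k) (p : CanopyVertex k H) {T : ℕ}
    (hp : p.1.1 ≤ T) (hT : T ≤ H) :
    ∃ q : CanopyVertex k H, q.1 = (T, canopyAncestor k T p.1) ∧
      ∃ w : (canopyTree k H).Walk p q, w.length = T - p.1.1 := by
  induction T, hp using Nat.le_induction with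
  | base => exact ⟨p, by rw [canopyAncestor_self], .nil, by simp⟩
  | succ T hp ih =>
    obtain ⟨q, hq, w, hw⟩ := ih (by omega)
    have hanc := canopyAncestor_canopyAncestor hk hp (Nat.le_succ T)
    refine ⟨⟨(T + 1, canopyAncestor k (T + 1) q.1), hT, ?_⟩, ?_, ?_⟩
    · refine lt_of_le_of_lt ?_ q.2.2
      have hq1 : q.1.1 ≤ T + 1 := by rw [hq]; exact Nat.le_succ T
      have := hk hq1
      simp only [canopyAncestor]
      calc q.1.2 / 2 ^ (k (T + 1) - k q.1.1) * 2 ^ k (T + 1)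
          = q.1.2 / 2 ^ (k (T + 1) - k q.1.1) * 2 ^ (k (T + 1) - k q.1.1) * 2 ^ k q.1.1 := by
            rw [mul_assoc, ← pow_add, Nat.sub_add_cancel this]
        _ ≤ q.1.2 * 2 ^ k q.1.1 := Nat.mul_le_mul_right _ (Nat.div_mul_le_self _ _)
    · simp only [hq]
      rw [hanc]
    · refine ⟨w.concat (Or.inl ⟨?_, rfl⟩), ?_⟩
      · simp [hq]
      · refine (SimpleGraph.Walk.length_concat _ _).trans ?_
        omega

theorem exists_walk_to_root (hk : Monotone k) (p : CanopyVertex k H) :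
    ∃ w : (canopyTree k H).Walk p (canopyRoot k H), w.length = H - p.1.1 := by
  obtain ⟨q, hq, w, hw⟩ := exists_walk_to_ancestor hk p p.2.1 le_rfl
  have hlt := q.2.2
  have hz : canopyAncestor k H p.1 = 0 := by
    rw [hq] at hlt
    simpa using hlt
  have : q = canopyRoot k H := Subtype.ext (by rw [hq, hz]; rfl)
  subst this
  exact ⟨w, hw⟩

theorem canopyTree_connected (hk : Monotone k) : (canopyTree k H).Connected := by
  have : Nonempty (CanopyVertex k H) := ⟨canopyRoot k H⟩
  refine ⟨fun p q => ?_⟩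
  obtain ⟨w, -⟩ := exists_walk_to_root hk p
  obtain ⟨v, -⟩ := exists_walk_to_root hk q
  exact ⟨w.append v.reverse⟩

theorem canopyTree_dist_root_le (hk : Monotone k) (p : CanopyVertex k H) :
    (canopyTree k H).dist (canopyRoot k H) p ≤ H := by
  obtain ⟨w, hw⟩ := exists_walk_to_root hk p
  rw [SimpleGraph.dist_comm]
  exact (SimpleGraph.dist_le w).trans (by omega)

theorem canopyTree_dist_le_of_ancestor_eq (hk : Monotone k) {p q : CanopyVertex k H} {T : ℕ}
    (hp : p.1.1 ≤ T) (hq : q.1.1 ≤ T) (h : canopyAncestor k T p.1 = canopyAncestor k T q.1) :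
    (canopyTree k H).dist p q ≤ (T - p.1.1) + (T - q.1.1) := by
  rcases le_total T H with hT | hT
  · obtain ⟨u, hu, w, hw⟩ := exists_walk_to_ancestor hk p hp hT
    obtain ⟨v, hv, z, hz⟩ := exists_walk_to_ancestor hk q hq hT
    have : u = v := Subtype.ext (by rw [hu, hv, h])
    subst this
    refine (SimpleGraph.dist_le (w.append z.reverse)).trans ?_
    simp [hw, hz]
  -- Level `T` may lie above the root; the path through the root is then short enough.
  · obtain ⟨w, hw⟩ := exists_walk_to_root hk p
    obtain ⟨z, hz⟩ := exists_walk_to_root hk q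
    refine (SimpleGraph.dist_le (w.append z.reverse)).trans ?_
    simp only [SimpleGraph.Walk.length_append, SimpleGraph.Walk.length_reverse, hw, hz]
    omega

/-- Each edge changes the level by one and leaves the ancestors at or above its upper end unchanged.
-/
theorem level_le_and_ancestor_eq_of_walk (hk : Monotone k) {p q : CanopyVertex k H}
    (w : (canopyTree k H).Walk p q) :
    p.1.1 ≤ q.1.1 + w.length ∧ q.1.1 ≤ p.1.1 + w.length ∧
      ∀ T, p.1.1 + w.length ≤ T → canopyAncestor k T p.1 = canopyAncestor k T q.1 := by
  induction w with
  | nil => simp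
  | @cons p u q h w ih =>
    obtain ⟨h1, h2, h3⟩ := ih
    rw [SimpleGraph.Walk.length_cons]
    have step : ∀ {a b : CanopyVertex k H} {T : ℕ}, b.1.1 = a.1.1 + 1 →
        b.1.2 = canopyAncestor k b.1.1 a.1 → b.1.1 ≤ T →
        canopyAncestor k T a.1 = canopyAncestor k T b.1 := by
      intro a b T hl hpos hT
      rw [← canopyAncestor_canopyAncestor hk (p := a.1) (S := b.1.1) (by omega) hT, ← hpos]
    rcases h with ⟨hl, hpos⟩ | ⟨hl, hpos⟩
    · exact ⟨by omega, by omega, fun T hT =>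
        (step hl hpos (by omega)).trans (h3 T (by omega))⟩
    · exact ⟨by omega, by omega, fun T hT =>
        (step hl hpos (by omega)).symm.trans (h3 T (by omega))⟩

end CanopyTree

/-! ### Covering balls by bands of levels -/

theorem exists_finset_representatives {α β : Type*} [DecidableEq β] [Finite α] (s : Set α)
    (f : α → β) (t : Finset β) (hst : ∀ a ∈ s, f a ∈ t) :
    ∃ F : Finset α, F.card ≤ t.card ∧ ∀ a ∈ s, ∃ b ∈ F, f b = f a := by
  classical
  let _ := Fintype.ofFinite α
  obtain ⟨u, hu, hinj⟩ := Set.exists_image_eq_and_injOn s f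
  refine ⟨Finset.univ.filter (· ∈ u), ?_, ?_⟩
  · refine Finset.card_le_card_of_injOn f ?_ ?_
    · intro a ha
      have ha : a ∈ u := by simpa using ha
      obtain ⟨b, hb, hab⟩ : f a ∈ f '' s := hu ▸ Set.mem_image_of_mem f ha
      rw [← hab]
      exact hst b hb
    · intro a ha b hb hab
      exact hinj (by simpa using ha) (by simpa using hb) hab
  · intro a ha
    obtain ⟨b, hb, hab⟩ : f a ∈ f '' u := hu ▸ Set.mem_image_of_mem f ha
    exact ⟨b, by simpa using hb, hab⟩

/-- A ball of radius `S` in the canopy tree is covered by few balls of radius `2 * (q - 1)`. -/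
theorem canopyTree_exists_cover {k : ℕ → ℕ} {H : ℕ} (hk : Monotone k) (x : CanopyVertex k H)
    (S m : ℕ) :
    ∃ F : Finset (CanopyVertex k H),
      F.card ≤ ∑ j ∈ Finset.Icc ((x.1.1 - S) / (m + 1)) ((x.1.1 + S) / (m + 1)),
        2 ^ (k ((m + 1) * ((x.1.1 + S) / (m + 1)) + m) - k ((m + 1) * j + m)) ∧
      ∀ y, (canopyTree k H).dist y x ≤ S → ∃ z ∈ F, (canopyTree k H).dist y z ≤ 2 * m := by
  set J := (x.1.1 + S) / (m + 1) with hJ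
  -- `T j` is the top level of band `j`.
  set T : ℕ → ℕ := fun j => (m + 1) * j + m with hTdef
  have hT : Monotone T := fun a b h => by simp only [hTdef]; gcongr
  have hlevel : ∀ h : ℕ, h ≤ T (h / (m + 1)) ∧ T (h / (m + 1)) ≤ h + m := by
    intro h
    have h1 := Nat.div_add_mod h (m + 1)
    have h2 := Nat.mod_lt h (Nat.add_pos_right m one_pos)
    simp only [hTdef]
    constructor <;> omega
  set c := canopyAncestor k (T J) x.1 with hc
  let e : ℕ → ℕ := fun j => 2 ^ (k (T J) - k (T j))
  obtain ⟨F, hF, hrep⟩ := exists_finset_representatives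
    {y : CanopyVertex k H | (canopyTree k H).dist y x ≤ S}
    (fun y => (⟨y.1.1 / (m + 1), canopyAncestor k (T (y.1.1 / (m + 1))) y.1⟩ : Σ _ : ℕ, ℕ))
    -- The ball lies below the ancestor `c` of `x` on level `T J`; on level `T j` the descendants of
    -- `c` form a block of `e j` positions.
    ((Finset.Icc ((x.1.1 - S) / (m + 1)) J).sigma
      fun j => Finset.Ico (c * e j) ((c + 1) * e j)) (by
    intro y hy
    obtain ⟨w, hw⟩ := ((canopyTree_connected hk).preconnected y x).exists_walk_length_eq_dist
    rw [Set.mem_ofPred_eq, ← hw] at hy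
    obtain ⟨h1, h2, -⟩ := level_le_and_ancestor_eq_of_walk hk w
    obtain ⟨-, -, h3⟩ := level_le_and_ancestor_eq_of_walk hk w.reverse
    rw [SimpleGraph.Walk.length_reverse] at h3
    have hyJ : y.1.1 / (m + 1) ≤ J := Nat.div_le_div_right (by omega)
    have hanc : canopyAncestor k (T J) x.1 = canopyAncestor k (T J) y.1 :=
      h3 _ ((by omega : x.1.1 + w.length ≤ x.1.1 + S).trans (hlevel _).1)
    rw [← canopyAncestor_canopyAncestor hk (hlevel y.1.1).1 (hT hyJ), ← hc] at hanc
    simp only [Finset.mem_sigma, Finset.mem_Icc, Finset.mem_Ico]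
    refine ⟨⟨Nat.div_le_div_right (by omega), hyJ⟩, ?_⟩
    have he : 0 < e (y.1.1 / (m + 1)) := by positivity
    rw [← Nat.le_div_iff_mul_le he, ← Nat.div_lt_iff_lt_mul he, hanc]
    exact ⟨le_rfl, Nat.lt_succ_self _⟩)
  refine ⟨F, hF.trans (le_of_eq ?_), fun y hy => ?_⟩
  · rw [Finset.card_sigma]
    refine Finset.sum_congr rfl fun j _ => ?_
    rw [Nat.card_Ico, add_mul, one_mul, Nat.add_sub_cancel_left]
  · obtain ⟨z, hz, hzy⟩ := hrep y hy
    refine ⟨z, hz, ?_⟩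
    simp only [Sigma.mk.injEq, heq_eq_eq] at hzy
    obtain ⟨hl, ha⟩ := hzy
    have hy' := hlevel y.1.1
    have hz' := hlevel z.1.1
    rw [hl] at ha hz'
    refine (canopyTree_dist_le_of_ancestor_eq hk hy'.1 hz'.1 ha.symm).trans ?_
    omega

/-- With `j = i + n ≤ J`, cross-multiplying gives `(J + 1) / (i + n + 1) ≤ (J - i + 1) / (n + 1)`;
the remaining series converges since `b > 1`. -/
theorem sum_Icc_div_rpow_le {b : ℝ} (hb : 1 < b) {i J : ℕ} (hi : i ≤ J) :
    ∑ j ∈ Finset.Icc i J, (((J : ℝ) + 1) / (j + 1)) ^ b ≤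
      (∑' n : ℕ, 1 / ((n : ℝ) + 1) ^ b) * ((J : ℝ) - i + 1) ^ b := by
  have hsum : Summable fun n : ℕ => 1 / ((n : ℝ) + 1) ^ b := by
    have := (summable_nat_add_iff 1).2 (Real.summable_one_div_nat_rpow.2 hb)
    simpa using this
  have hiJ : (i : ℝ) ≤ J := by exact_mod_cast hi
  calc ∑ j ∈ Finset.Icc i J, (((J : ℝ) + 1) / (j + 1)) ^ b
      = ∑ n ∈ Finset.range (J + 1 - i), (((J : ℝ) + 1) / ((i + n : ℕ) + 1)) ^ b := by
        rw [← Finset.Ico_add_one_right_eq_Icc, Finset.sum_Ico_eq_sum_range]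
    _ ≤ ∑ n ∈ Finset.range (J + 1 - i), 1 / ((n : ℝ) + 1) ^ b * ((J : ℝ) - i + 1) ^ b := by
        refine Finset.sum_le_sum fun n hn => ?_
        have hn' : n + i ≤ J := by have := Finset.mem_range.1 hn; omega
        have hnJ : (n : ℝ) + i ≤ J := by exact_mod_cast hn'
        have hn0 : (0 : ℝ) ≤ n := n.cast_nonneg
        have hi0 : (0 : ℝ) ≤ i := i.cast_nonneg
        rw [one_div_mul_eq_div, ← Real.div_rpow (by linarith) (by positivity)]
        refine Real.rpow_le_rpow (by positivity) ?_ (by linarith)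
        push_cast
        rw [div_le_div_iff₀ (by positivity) (by positivity)]
        nlinarith
    _ = (∑ n ∈ Finset.range (J + 1 - i), 1 / ((n : ℝ) + 1) ^ b) * ((J : ℝ) - i + 1) ^ b := by
        rw [Finset.sum_mul]
    _ ≤ _ := by
        refine mul_le_mul_of_nonneg_right ?_ (Real.rpow_nonneg (by linarith) _)
        exact hsum.sum_le_tsum _ fun n _ => by positivity

/-- The integer part of `log₂ ((h + 1) ^ β)`. -/
noncomputable def logLevel (β : ℝ) (h : ℕ) : ℕ := ⌊β * Real.logb 2 ((h : ℝ) + 1)⌋₊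

section LogLevel

variable {β : ℝ}

theorem logLevel_zero : logLevel β 0 = 0 := by simp [logLevel]

theorem logLevel_mono (hβ : 0 ≤ β) : Monotone (logLevel β) := by
  intro a b hab
  have hab' : (a : ℝ) ≤ b := by exact_mod_cast hab
  have ha : (0 : ℝ) ≤ a := a.cast_nonneg
  refine Nat.floor_mono (mul_le_mul_of_nonneg_left ?_ hβ)
  exact Real.logb_le_logb_of_le (by norm_num) (by linarith) (by linarith)

theorem two_rpow_mul_logb (β : ℝ) (h : ℕ) :
    (2 : ℝ) ^ (β * Real.logb 2 ((h : ℝ) + 1)) = ((h : ℝ) + 1) ^ β := by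
  rw [mul_comm, Real.rpow_mul (by norm_num), Real.rpow_logb (by norm_num) (by norm_num)
    (by positivity)]

theorem two_pow_logLevel_le (hβ : 0 ≤ β) (h : ℕ) :
    (2 : ℝ) ^ logLevel β h ≤ ((h : ℝ) + 1) ^ β := by
  have hh : (0 : ℝ) ≤ h := h.cast_nonneg
  rw [← two_rpow_mul_logb, ← Real.rpow_natCast]
  refine Real.rpow_le_rpow_of_exponent_le (by norm_num) (Nat.floor_le ?_)
  exact mul_nonneg hβ (Real.logb_nonneg (by norm_num) (by linarith))

theorem rpow_le_two_mul_two_pow_logLevel (β : ℝ) (h : ℕ) :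
    ((h : ℝ) + 1) ^ β ≤ 2 * 2 ^ logLevel β h := by
  rw [← two_rpow_mul_logb, ← pow_succ', ← Real.rpow_natCast]
  refine Real.rpow_le_rpow_of_exponent_le (by norm_num) ?_
  push_cast
  exact (Nat.lt_floor_add_one _).le

theorem two_pow_logLevel_sub_le (hβ : 0 ≤ β) {a b : ℕ} (hab : a ≤ b) :
    (2 : ℝ) ^ (logLevel β b - logLevel β a) ≤ 2 * (((b : ℝ) + 1) / (a + 1)) ^ β := by
  have ha : (0 : ℝ) < ((a : ℝ) + 1) ^ β := by positivity
  rw [pow_sub₀ _ (by norm_num) (logLevel_mono hβ hab), ← div_eq_mul_inv,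
    Real.div_rpow (by positivity) (by positivity), ← mul_div_assoc,
    div_le_div_iff₀ (by positivity) ha]
  have h1 := two_pow_logLevel_le hβ b
  have h2 := rpow_le_two_mul_two_pow_logLevel β a
  calc (2 : ℝ) ^ logLevel β b * ((a : ℝ) + 1) ^ β
      ≤ ((b : ℝ) + 1) ^ β * (2 * 2 ^ logLevel β a) := by gcongr
    _ = _ := by ring

end LogLevel

/-! ### The two bounds on the dimension -/

theorem coveringCondition_canopyTree {ι : Type*} (H : ι → ℕ) {β b : ℝ} (hβ : 1 ≤ β) (hb : β < b) :
    CoveringCondition (fun i => CanopyVertex (logLevel β) (H i)) (fun i => shortestPathMetric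
      (canopyTree (logLevel β) (H i)) (canopyTree_connected (logLevel_mono (by linarith)))) b := by
  have hβ0 : 0 ≤ β := by linarith
  have hk := logLevel_mono hβ0
  set Z : ℝ := ∑' n : ℕ, 1 / ((n : ℝ) + 1) ^ b with hZ
  have hZ0 : 0 ≤ Z := tsum_nonneg fun n => by positivity
  -- The 2 pays for the floor in `logLevel`, the 6 for the number of bands; `Z + 1` is visibly
  -- positive.
  refine ⟨2 * (Z + 1) * 6 ^ b, by positivity, fun i x r R hr hrR => ?_⟩
  set S := ⌊R⌋₊
  set m := ⌊r / 2⌋₊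
  have hS : (S : ℝ) ≤ R := Nat.floor_le (by linarith)
  have hm : (m : ℝ) ≤ r / 2 := Nat.floor_le (by linarith)
  have hm' : r / 2 < m + 1 := Nat.lt_floor_add_one _
  obtain ⟨F, hF, hcov⟩ := canopyTree_exists_cover hk x S m
  set j₀ := (x.1.1 - S) / (m + 1)
  set J := (x.1.1 + S) / (m + 1)
  have hj₀J : j₀ ≤ J := Nat.div_le_div_right (by omega)
  have hn : (J : ℝ) - j₀ + 1 ≤ 6 * (R / r) := by
    have h1 : J * (m + 1) ≤ x.1.1 + S := Nat.div_mul_le_self _ _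
    have h2 : x.1.1 - S < (j₀ + 1) * (m + 1) := by
      rw [mul_comm]; exact Nat.lt_mul_div_succ _ (Nat.succ_pos m)
    have h3 : J * (m + 1) ≤ 2 * S + (j₀ + 1) * (m + 1) := by omega
    have h4 : (J : ℝ) * (m + 1) ≤ 2 * S + (j₀ + 1) * (m + 1) := by exact_mod_cast h3
    have hm0 : (0 : ℝ) < m + 1 := by positivity
    have h5 : (J : ℝ) - j₀ - 1 ≤ 2 * R / (m + 1) := by
      rw [le_div_iff₀ hm0]; nlinarith
    have h6 : 2 * R / (m + 1) ≤ 2 * R / (r / 2) :=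
      div_le_div_of_nonneg_left (by linarith) (by linarith) hm'.le
    have h7 : 2 * R / (r / 2) = 4 * (R / r) := by field_simp; ring
    have h8 : 1 ≤ R / r := by rw [le_div_iff₀ hr]; linarith
    linarith
  refine ⟨F, ?_, fun y hy => ?_⟩
  · have hj : (0 : ℝ) ≤ (J : ℝ) - j₀ + 1 := by
      have : (j₀ : ℝ) ≤ J := by exact_mod_cast hj₀J
      linarith
    calc (F.card : ℝ) ≤ ∑ j ∈ Finset.Icc j₀ J,
          (2 : ℝ) ^ (logLevel β ((m + 1) * J + m) - logLevel β ((m + 1) * j + m)) := by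
          exact_mod_cast hF
      _ ≤ ∑ j ∈ Finset.Icc j₀ J, 2 * (((J : ℝ) + 1) / (j + 1)) ^ b := by
          refine Finset.sum_le_sum fun j hj => ?_
          have hjJ := (Finset.mem_Icc.1 hj).2
          have hjJ' : (j : ℝ) ≤ J := by exact_mod_cast hjJ
          refine (two_pow_logLevel_sub_le hβ0 (by gcongr)).trans ?_
          -- The top level of band `j`, plus one, is `(m + 1) * (j + 1)`, so the band width cancels.
          have heq : ((((m + 1) * J + m : ℕ) : ℝ) + 1) / (((m + 1) * j + m : ℕ) + 1) =
              ((J : ℝ) + 1) / (j + 1) := by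
            push_cast
            rw [div_eq_div_iff (by positivity) (by positivity)]
            ring
          rw [heq]
          refine mul_le_mul_of_nonneg_left ?_ (by norm_num)
          refine Real.rpow_le_rpow_of_exponent_le ?_ hb.le
          rw [le_div_iff₀ (by positivity)]
          linarith
      _ = 2 * ∑ j ∈ Finset.Icc j₀ J, (((J : ℝ) + 1) / (j + 1)) ^ b := by rw [Finset.mul_sum]
      _ ≤ 2 * (Z * ((J : ℝ) - j₀ + 1) ^ b) := by
          gcongr
          exact sum_Icc_div_rpow_le (by linarith) hj₀J
      _ ≤ 2 * ((Z + 1) * (6 * (R / r)) ^ b) := by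
          gcongr <;> linarith
      _ = 2 * (Z + 1) * 6 ^ b * (R / r) ^ b := by
          rw [Real.mul_rpow (by norm_num) (div_nonneg (by linarith) hr.le)]
          ring
  · have hy' : ((canopyTree (logLevel β) (H i)).dist y x : ℝ) ≤ R := hy
    obtain ⟨z, hz, hyz⟩ := hcov y (Nat.le_floor hy')
    refine Set.mem_iUnion₂.2 ⟨z, hz, ?_⟩
    change ((canopyTree (logLevel β) (H i)).dist y z : ℝ) ≤ r
    have : ((canopyTree (logLevel β) (H i)).dist y z : ℝ) ≤ 2 * m := by exact_mod_cast hyz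
    linarith

/-- As `k 0 = 0`, level 0 alone has `2 ^ k H` vertices. -/
theorem card_le_of_canopyTree_cover {k : ℕ → ℕ} {H : ℕ} (hk0 : k 0 = 0)
    (F : Finset (CanopyVertex k H)) (hF : ∀ y, y ∈ F) : 2 ^ k H ≤ F.card := by
  rw [← Fintype.card_fin (2 ^ k H), ← Finset.card_univ]
  refine Finset.card_le_card_of_injOn (fun a => ⟨(0, a), Nat.zero_le _, by simp [hk0]⟩)
    (fun a _ => hF _) fun a _ b _ hab => ?_
  have := congrArg (fun p : CanopyVertex k H => p.1.2) hab
  exact Fin.ext this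

theorem le_of_coveringCondition_canopyTree {ι : Type*} {H : ι → ℕ} (hH : Function.Surjective H)
    {β b : ℝ} (hβ : 0 ≤ β)
    (h : CoveringCondition (fun i => CanopyVertex (logLevel β) (H i)) (fun i => shortestPathMetric
      (canopyTree (logLevel β) (H i)) (canopyTree_connected (logLevel_mono hβ))) b) :
    β ≤ b := by
  have hk := logLevel_mono hβ
  obtain ⟨C, hC, hcov⟩ := h
  by_contra! hb
  have hbound : ∀ n : ℕ, 1 ≤ n → (n : ℝ) ^ (β - b) ≤ 2 * C * 2 ^ b := by
    intro n hn
    obtain ⟨i, rfl⟩ := hH n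
    have hn' : (1 : ℝ) ≤ H i := by exact_mod_cast hn
    -- Distances are integers, so a cover at scale `1 / 2` must contain every vertex.
    obtain ⟨F, hF, hsub⟩ := hcov i (canopyRoot _ _) (1 / 2) (H i) (by norm_num) (by linarith)
    have hmem : ∀ y, y ∈ F := by
      intro y
      have hy : y ∈ ⋃ z ∈ F, @Metric.closedBall _ (shortestPathMetric
          (canopyTree (logLevel β) (H i)) (canopyTree_connected hk)).toPseudoMetricSpace z
          (1 / 2) := by
        refine hsub ?_
        change ((canopyTree (logLevel β) (H i)).dist y (canopyRoot _ _) : ℝ) ≤ H i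
        rw [SimpleGraph.dist_comm]
        exact_mod_cast canopyTree_dist_root_le hk y
      obtain ⟨z, hz, hyz⟩ := Set.mem_iUnion₂.1 hy
      have hyz : ((canopyTree (logLevel β) (H i)).dist y z : ℝ) ≤ 1 / 2 := hyz
      have hlt : (canopyTree (logLevel β) (H i)).dist y z < 1 := by
        have : ((canopyTree (logLevel β) (H i)).dist y z : ℝ) < 1 := by linarith
        exact_mod_cast this
      have := (canopyTree_connected hk).dist_eq_zero_iff.1 (Nat.lt_one_iff.1 hlt)
      rwa [this]
    have hcard : (2 : ℝ) ^ logLevel β (H i) ≤ F.card := by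
      exact_mod_cast card_le_of_canopyTree_cover logLevel_zero F hmem
    have hpos : (0 : ℝ) < H i := by linarith
    rw [Real.rpow_sub hpos, div_le_iff₀ (by positivity)]
    calc (H i : ℝ) ^ β ≤ ((H i : ℝ) + 1) ^ β := by gcongr; linarith
      _ ≤ 2 * 2 ^ logLevel β (H i) := rpow_le_two_mul_two_pow_logLevel β _
      _ ≤ 2 * (C * ((H i : ℝ) / (1 / 2)) ^ b) := by gcongr; exact hcard.trans hF
      _ = 2 * C * 2 ^ b * (H i : ℝ) ^ b := by
        rw [div_div_eq_mul_div, div_one, Real.mul_rpow hpos.le (by norm_num)]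
        ring
  have htend : Filter.Tendsto (fun n : ℕ => (n : ℝ) ^ (β - b)) Filter.atTop Filter.atTop :=
    (tendsto_rpow_atTop (by linarith)).comp tendsto_natCast_atTop_atTop
  obtain ⟨n, hn1, hn2⟩ := ((Filter.eventually_ge_atTop 1).and
    (htend.eventually_gt_atTop (2 * C * 2 ^ b))).exists
  exact absurd (hbound n hn1) (not_le.2 hn2)

theorem assouadDim_canopyTree {ι : Type*} {H : ι → ℕ} (hH : Function.Surjective H)
    {β : ℝ} (hβ : 1 ≤ β) :
    assouadDim (fun i => CanopyVertex (logLevel β) (H i)) (fun i => shortestPathMetric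
      (canopyTree (logLevel β) (H i))
      (canopyTree_connected (logLevel_mono (by linarith)))) = (β : EReal) := by
  refine le_antisymm (EReal.le_of_forall_lt_iff_le.1 fun b hb => ?_) (le_sInf ?_)
  · exact sInf_le ⟨b, rfl, coveringCondition_canopyTree H hβ (EReal.coe_lt_coe_iff.1 hb)⟩
  · rintro _ ⟨b, rfl, h⟩
    exact EReal.coe_le_coe_iff.2 (le_of_coveringCondition_canopyTree hH (by linarith) h)

theorem mainTheorem7 (β : ℝ) (hβ : 1 ≤ β) :
    ∃ (V : {δ : ℝ // 0 < δ} → Type) (G : ∀ δ, SimpleGraph (V δ)) (hG : ∀ δ, (G δ).Connected),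
      (∀ δ, Finite (V δ)) ∧
        assouadDim V (fun δ => shortestPathMetric (G δ) (hG δ)) = (β : EReal) := by
  have hsurj : Function.Surjective fun δ : {δ : ℝ // 0 < δ} => ⌊δ.1⌋₊ := by
    intro n
    -- The shift by `1 / 2` keeps `δ` positive when `n = 0`.
    refine ⟨⟨(n : ℝ) + 1 / 2, by positivity⟩, ?_⟩
    rw [Nat.floor_eq_iff (by positivity)]
    constructor <;> linarith
  exact ⟨fun δ => CanopyVertex (logLevel β) ⌊δ.1⌋₊, fun δ => canopyTree (logLevel β) ⌊δ.1⌋₊,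
    fun δ => canopyTree_connected (logLevel_mono (by linarith)), fun δ => canopyVertex_finite,
    assouadDim_canopyTree hsurj hβ⟩
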